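/- Let $(X,d)$ be a proper geodesic Gromov hyperbolic metric space (for some $\delta>0$, every side of every geodesic triangle lies in the $\delta$-neighborhood of the union of the other two). Let $\partial_GX$ be its Gromov boundary (geodesic rays modulo being at bounded distance) and $\overline X^G=X\sqcup\partial_GX$ its Gromov compactification with the usual topology. Let $f\colon X\to X$ be non-expanding, i.e. $d(f(x),f(y))\le d(x,y)$ for all $x,y\in X$. For a non-expanding map $g\colon X\to X$, $\eta\in\partial_GX$ and $p\in X$, the dilation $\lambda_{\eta,p}(g)$ of $g$ at $\eta$ with respect to $p$ is defined by $$\log\lambda_{\eta,p}(g)=\liminf_{z\to\eta}\bigl(d(z,p)-d(g(z),p)\bigr),\qquad z\in X.$$ The point $\eta$ is called a boundary regular fixed point (BRFP) of $g$ if $\lambda_{\eta,p}(g)<+\infty$ for some (equivalently, every) $p\in X$ and $g$ has geodesic limit $\eta$ at $\eta$, that is, $g(x_n)\to\eta$ for every sequence $(x_n)$ in $X$ that converges to $\eta$ and is contained in a set $\{x\in X: d(x,\gamma)<R\}$ with $R>0$ and $\gamma$ a geodesic ray with endpoint $\eta$. Theorem. Let $\eta\in\partial_GX$ be a BRFP of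 $f$. Then for every $n\ge1$ the point $\eta$ is a BRFP of the iterate $f^n$, and $0<\lambda_{\eta,p}(f^n)<+\infty$ for every $p\in X$. For every $p\in X$ the sequence $(\log\lambda_{\eta,p}(f^n))_{n\ge1}$ is superadditive: $$\log\lambda_{\eta,p}(f^{n})+\log\lambda_{\eta,p}(f^{m})\le\log\lambda_{\eta,p}(f^{n+m})\qquad\text{for all } n,m\ge1.$$ Moreover, the limit $$\log\Lambda_\eta:=\lim_{n\to\infty}\frac{\log\lambda_{\eta,p}(f^n)}{n}$$ exists, is finite (so $0<\Lambda_\eta<+\infty$), and does not depend on $p\in X$. -/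

import Mathlib

open Filter Topology
open scoped NNReal ENNReal

noncomputable section

/-! ### Geodesic and Gromov hyperbolic spaces -/

/-- `S` is (the image of) a geodesic segment from `x` to `y`. -/
def IsGeodesicSegment {X : Type*} [MetricSpace X] (S : Set X) (x y : X) : Prop :=
  ∃ c : ℝ → X, c 0 = x ∧ c (dist x y) = y ∧
    (∀ s ∈ Set.Icc 0 (dist x y), ∀ t ∈ Set.Icc 0 (dist x y), dist (c s) (c t) = |s - t|) ∧
    S = c '' Set.Icc 0 (dist x y)

/-- Every two points are joined by a geodesic segment. -/
def IsGeodesicSpace (X : Type*) [MetricSpace X] : Prop :=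
  ∀ x y : X, ∃ S : Set X, IsGeodesicSegment S x y

/-- Thin triangles: in every geodesic triangle, any side lies in the `δ`-neighborhood of the union
of the two other sides. All triangles are quantified over, so it is enough to name one side. -/
def IsDeltaHyperbolic (X : Type*) [MetricSpace X] (δ : ℝ) : Prop :=
  ∀ (x y z : X) (S T U : Set X),
    IsGeodesicSegment S x y → IsGeodesicSegment T y z → IsGeodesicSegment U x z →
      S ⊆ Metric.thickening δ (T ∪ U)

/-- The space is `δ`-hyperbolic for some `δ > 0`. -/
def IsGromovHyperbolic (X : Type*) [MetricSpace X] : Prop :=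
  ∃ δ : ℝ, 0 < δ ∧ IsDeltaHyperbolic X δ

/-! ### The Gromov boundary -/

/-- Geodesic rays: isometric maps `[0, ∞) → X`. -/
def GeodesicRay (X : Type*) [MetricSpace X] : Type _ :=
  {γ : ℝ≥0 → X // Isometry γ}

/-- Two rays are asymptotic if they stay at bounded distance from each other. -/
def GeodesicRay.Asymptotic {X : Type*} [MetricSpace X] (γ σ : GeodesicRay X) : Prop :=
  ∃ M : ℝ, ∀ t : ℝ≥0, dist (γ.1 t) (σ.1 t) ≤ M

/-- Being asymptotic is an equivalence relation on geodesic rays. -/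
def asymptoticSetoid (X : Type*) [MetricSpace X] : Setoid (GeodesicRay X) where
  r := GeodesicRay.Asymptotic
  iseqv :=
    { refl := fun γ => ⟨0, fun t => (dist_self (γ.1 t)).le⟩
      symm := fun {γ σ} h => by
        obtain ⟨M, hM⟩ := h
        exact ⟨M, fun t => by rw [dist_comm]; exact hM t⟩
      trans := fun {γ σ τ} h h' => by
        obtain ⟨M, hM⟩ := h
        obtain ⟨N, hN⟩ := h'
        exact ⟨M + N, fun t => (dist_triangle _ (σ.1 t) _).trans (add_le_add (hM t) (hN t))⟩ }

/-- The Gromov boundary: geodesic rays up to asymptoticity. -/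
def GromovBoundary (X : Type*) [MetricSpace X] : Type _ :=
  Quotient (asymptoticSetoid X)

/-- The endpoint `[γ]` of a geodesic ray. -/
def GeodesicRay.endpoint {X : Type*} [MetricSpace X] (γ : GeodesicRay X) : GromovBoundary X :=
  Quotient.mk (asymptoticSetoid X) γ

/-! ### The Gromov compactification -/

/-- The disjoint union of the space and its Gromov boundary. It does not carry the topology of the
disjoint union: its topology is defined below. -/
inductive GromovCompactification (X : Type*) [MetricSpace X] : Type _
  | of (x : X) : GromovCompactification X
  | bdry (η : GromovBoundary X) : GromovCompactification X

/-- The Gromov product `(x, y)_p`. -/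
def gromovProduct {X : Type*} [MetricSpace X] (p x y : X) : ℝ :=
  (dist x p + dist y p - dist x y) / 2

/-- Paths representing a point of the compactification: the constant path for a point of `X`, the
geodesic rays ending at `η` (from any starting point) for a boundary point `η`. -/
def Represents {X : Type*} [MetricSpace X] (c : ℝ≥0 → X) : GromovCompactification X → Prop
  | .of x => c = fun _ => x
  | .bdry η => ∃ γ : GeodesicRay X, γ.endpoint = η ∧ c = γ.1

/-- The basic neighborhood of the boundary point `η` consisting of the points `ξ` of the
compactification with Gromov product `(ξ, η)_p` at least `R`, where the Gromov product is extended
to the boundary by limits along representing paths. -/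
def gromovNhd {X : Type*} [MetricSpace X] (p : X) (η : GromovBoundary X) (R : ℝ) :
    Set (GromovCompactification X) :=
  {ξ | ∀ c c' : ℝ≥0 → X, Represents c ξ → Represents c' (.bdry η) →
    ∀ᶠ st : ℝ≥0 × ℝ≥0 in atTop, R ≤ gromovProduct p (c st.1) (c' st.2)}

/-- The topology of the Gromov compactification: `U` is open if its trace on `X` is open and if it
contains a basic neighborhood of each of its boundary points (the choice of the base point is
immaterial). -/
instance GromovCompactification.instTopologicalSpace (X : Type*) [MetricSpace X] :
    TopologicalSpace (GromovCompactification X) where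
  IsOpen U := IsOpen {x : X | GromovCompactification.of x ∈ U} ∧
    ∀ η : GromovBoundary X, GromovCompactification.bdry η ∈ U →
      ∀ p : X, ∃ R : ℝ, gromovNhd p η R ⊆ U
  isOpen_univ := ⟨by simp, fun _ _ _ => ⟨0, Set.subset_univ _⟩⟩
  isOpen_inter := by
    rintro U V ⟨hU, hU'⟩ ⟨hV, hV'⟩
    refine ⟨hU.inter hV, fun η hη p => ?_⟩
    obtain ⟨R, hR⟩ := hU' η hη.1 p
    obtain ⟨S, hS⟩ := hV' η hη.2 p
    refine ⟨max R S, fun ξ hξ => ⟨hR fun c c' h h' => ?_, hS fun c c' h h' => ?_⟩⟩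
    · exact (hξ c c' h h').mono fun _ h => (le_max_left _ _).trans h
    · exact (hξ c c' h h').mono fun _ h => (le_max_right _ _).trans h
  isOpen_sUnion := by
    intro 𝒰 h𝒰
    refine ⟨?_, ?_⟩
    · have : {x : X | GromovCompactification.of x ∈ ⋃₀ 𝒰} =
          ⋃ U ∈ 𝒰, {x : X | GromovCompactification.of x ∈ U} := by
        ext x; simp
      rw [this]
      exact isOpen_biUnion fun U hU => (h𝒰 U hU).1
    · rintro η ⟨U, hU, hη⟩ p
      obtain ⟨R, hR⟩ := (h𝒰 U hU).2 η hη p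
      exact ⟨R, hR.trans (Set.subset_sUnion_of_mem hU)⟩

/-- The filter on `X` describing `z → η` with `z` in `X`, for a boundary point `η`. -/
def toBoundary {X : Type*} [MetricSpace X] (η : GromovBoundary X) : Filter X :=
  comap GromovCompactification.of (𝓝 (GromovCompactification.bdry η))

/-! ### Geodesic limits, dilation, boundary regular fixed points -/

/-- The geodesic region `A(γ, R)`; its vertex is `γ.endpoint`. -/
def geodesicRegion {X : Type*} [MetricSpace X] (γ : GeodesicRay X) (R : ℝ) : Set X :=
  Metric.thickening R (Set.range γ.1)

/-- `g` has geodesic limit `ξ` at `η`. -/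
def HasGeodesicLimit {X Y : Type*} [MetricSpace X] [TopologicalSpace Y] (g : X → Y)
    (η : GromovBoundary X) (ξ : Y) : Prop :=
  ∀ (γ : GeodesicRay X) (R : ℝ) (x : ℕ → X), γ.endpoint = η → 0 < R →
    (∀ n, x n ∈ geodesicRegion γ R) → Tendsto x atTop (toBoundary η) →
      Tendsto (fun n => g (x n)) atTop (𝓝 ξ)

/-- The dilation `λ_{η,p}(f)`, in `[0, ∞]`, defined by
`log λ_{η,p}(f) = liminf_{z → η} (d(z, p) - d(f(z), p))`. -/
def dilation {X : Type*} [MetricSpace X] (f : X → X) (η : GromovBoundary X) (p : X) : ℝ≥0∞ :=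
  EReal.exp (liminf (fun z : X => ((dist z p - dist (f z) p : ℝ) : EReal)) (toBoundary η))

/-- Boundary regular fixed points: finite dilation (with respect to some base point, equivalently
to all of them), and geodesic limit `η` at `η`. -/
def IsBRFP {X : Type*} [MetricSpace X] (f : X → X) (η : GromovBoundary X) : Prop :=
  (∃ p : X, dilation f η p < ⊤) ∧
    HasGeodesicLimit (fun z => GromovCompactification.of (f z)) η (GromovCompactification.bdry η)

end

/-! ### Geodesic segments and the four point inequality -/

section Segments

variable {X : Type*} [MetricSpace X]

/-! The key fact is that `f` moves the points of any geodesic ray ending at `η` by at most some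
constant `K` (`exists_dist_ray_le`). Finite dilation makes `f` recede from `p` at full speed along
the ray, the geodesic limit fixes the direction, and hyperbolicity then keeps `f (γ t)` close to `γ
t`. Non-expansion gives displacement at most `n * K` for the `n`-th iterate. Hence the iterates have
geodesic limit `η` and `logDilation` at most `n * K`.

Superadditivity comes from the cocycle identity `approach_comp`. The difficulty is that `g z` need
not tend to `η` when `z` does. It does so where `approach g p z` stays bounded above
(`tendsto_of_approach_le`); where `approach g p z` is large, the crude bound `neg_dist_le_approach`
for `f` suffices. Fekete's lemma then gives the limit, finite by the linear bound. Changing the base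
point costs at most `2 * dist p q`, which disappears after division by `n`. -/

theorem IsGeodesicSegment.left_mem {S : Set X} {x y : X} (h : IsGeodesicSegment S x y) :
    x ∈ S := by
  obtain ⟨c, h0, -, -, rfl⟩ := h
  exact ⟨0, ⟨le_rfl, dist_nonneg⟩, h0⟩

theorem IsGeodesicSegment.right_mem {S : Set X} {x y : X} (h : IsGeodesicSegment S x y) :
    y ∈ S := by
  obtain ⟨c, -, h1, -, rfl⟩ := h
  exact ⟨dist x y, ⟨dist_nonneg, le_rfl⟩, h1⟩

theorem IsGeodesicSegment.dist_add_dist {S : Set X} {x y u : X} (h : IsGeodesicSegment S x y)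
    (hu : u ∈ S) : dist x u + dist u y = dist x y := by
  obtain ⟨c, h0, h1, hc, rfl⟩ := h
  obtain ⟨t, ht, rfl⟩ := hu
  have e0 := hc 0 ⟨le_rfl, dist_nonneg⟩ t ht
  have e1 := hc t ht (dist x y) ⟨dist_nonneg, le_rfl⟩
  rw [h0, zero_sub, abs_neg, abs_of_nonneg ht.1] at e0
  rw [h1, abs_sub_comm, abs_of_nonneg (sub_nonneg.2 ht.2)] at e1
  linarith

theorem IsGeodesicSegment.isPreconnected {S : Set X} {x y : X} (h : IsGeodesicSegment S x y) :
    IsPreconnected S := by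
  obtain ⟨c, -, -, hc, rfl⟩ := h
  refine isPreconnected_Icc.image c ?_
  have : LipschitzOnWith 1 c (Set.Icc 0 (dist x y)) :=
    LipschitzOnWith.of_dist_le_mul fun s hs t ht => by
      rw [hc s hs t ht, Real.dist_eq, NNReal.coe_one, one_mul]
  exact this.continuousOn

theorem gromovProduct_comm (p x y : X) : gromovProduct p x y = gromovProduct p y x := by
  simp only [gromovProduct, dist_comm x y]; ring

theorem gromovProduct_le_dist {S : Set X} {p x y u : X} (h : IsGeodesicSegment S x y)
    (hu : u ∈ S) : gromovProduct p x y ≤ dist p u := by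
  have h1 := h.dist_add_dist hu
  have h2 := dist_triangle x u p
  have h3 := dist_triangle_left y p u
  rw [dist_comm u p] at h2
  rw [dist_comm u p] at h3
  unfold gromovProduct
  linarith

/-- The side `S` is connected and covered by the open `δ`-neighborhoods of the other two sides, each
of which meets it. Some point of `S` is therefore `δ`-close to both, and triangle inequalities bound
its distance to `p`. -/
theorem IsDeltaHyperbolic.exists_dist_le_gromovProduct {δ : ℝ} (hδ : 0 < δ)
    (hgeo : IsGeodesicSpace X) (hX : IsDeltaHyperbolic X δ) {S : Set X} {x y : X}
    (hS : IsGeodesicSegment S x y) (p : X) :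
    ∃ w ∈ S, dist p w ≤ gromovProduct p x y + 2 * δ := by
  obtain ⟨T, hT⟩ := hgeo y p
  obtain ⟨U, hU⟩ := hgeo x p
  have hcov := hX x y p S T U hS hT hU
  rw [Metric.thickening_union] at hcov
  obtain ⟨w, hw, hwT, hwU⟩ := hS.isPreconnected _ _ Metric.isOpen_thickening
    Metric.isOpen_thickening hcov
    ⟨y, hS.right_mem, Metric.self_subset_thickening hδ _ hT.left_mem⟩
    ⟨x, hS.left_mem, Metric.self_subset_thickening hδ _ hU.left_mem⟩
  obtain ⟨v, hv, hwv⟩ := Metric.mem_thickening_iff.1 hwT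
  obtain ⟨u, hu, hwu⟩ := Metric.mem_thickening_iff.1 hwU
  refine ⟨w, hw, ?_⟩
  have e1 := hS.dist_add_dist hw
  have e2 := hT.dist_add_dist hv
  have e3 := hU.dist_add_dist hu
  have t1 := dist_triangle x u w
  have t2 := dist_triangle p u w
  have t3 := dist_triangle y v w
  have t4 := dist_triangle p v w
  simp only [dist_comm u w, dist_comm v w, dist_comm p u, dist_comm p v, dist_comm y w] at *
  unfold gromovProduct
  linarith

/-- The four point inequality for the Gromov product, with constant `δ`. -/
def FourPointInequality (X : Type*) [MetricSpace X] (δ : ℝ) : Prop :=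
  ∀ p x y z : X, min (gromovProduct p x y) (gromovProduct p y z) ≤ gromovProduct p x z + δ

theorem IsDeltaHyperbolic.fourPointInequality {δ : ℝ} (hδ : 0 < δ)
    (hgeo : IsGeodesicSpace X) (hX : IsDeltaHyperbolic X δ) :
    FourPointInequality X (3 * δ) := by
  intro p x y z
  obtain ⟨S, hS⟩ := hgeo x z
  obtain ⟨T, hT⟩ := hgeo z y
  obtain ⟨U, hU⟩ := hgeo x y
  obtain ⟨w, hw, hpw⟩ := hX.exists_dist_le_gromovProduct hδ hgeo hS p
  -- The constant `3 * δ` is `2 * δ` from the choice of `w`, plus `δ` for passing to a point `u` of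
  -- another side.
  obtain ⟨u, hu, hwu⟩ := Metric.mem_thickening_iff.1 (hX x z y S T U hS hT hU hw)
  have t := dist_triangle p w u
  rcases hu with hu | hu
  · have h1 := gromovProduct_le_dist (p := p) hT hu
    have h2 := gromovProduct_comm p y z
    exact (min_le_right _ _).trans (by linarith)
  · have h1 := gromovProduct_le_dist (p := p) hU hu
    exact (min_le_left _ _).trans (by linarith)

theorem gromovProduct_le_add_dist_base (p q x y : X) :
    gromovProduct p x y ≤ gromovProduct q x y + dist p q := by
  have h1 := dist_triangle_right x p q
  have h2 := dist_triangle_right y p q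
  unfold gromovProduct
  linarith

theorem gromovProduct_le_add_dist_left (p x x' y : X) :
    gromovProduct p x y ≤ gromovProduct p x' y + dist x x' := by
  have h1 := dist_triangle x x' p
  have h2 := dist_triangle_left x' y x
  unfold gromovProduct
  linarith

end Segments

/-! ### Geodesic rays -/

section Rays

variable {X : Type*} [MetricSpace X]

theorem GeodesicRay.dist_eq (γ : GeodesicRay X) (s t : ℝ≥0) :
    dist (γ.1 s) (γ.1 t) = |(s : ℝ) - t| := by
  rw [γ.2.dist_eq, NNReal.dist_eq]

theorem GeodesicRay.dist_le_add (γ : GeodesicRay X) (p : X) (t : ℝ≥0) :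
    dist (γ.1 t) p ≤ t + dist (γ.1 0) p := by
  have h := γ.dist_eq t 0
  rw [NNReal.coe_zero, sub_zero, abs_of_nonneg t.coe_nonneg] at h
  linarith [dist_triangle (γ.1 t) (γ.1 0) p]

theorem GeodesicRay.le_dist_add (γ : GeodesicRay X) (p : X) (t : ℝ≥0) :
    t ≤ dist (γ.1 t) p + dist (γ.1 0) p := by
  have h := γ.dist_eq t 0
  rw [NNReal.coe_zero, sub_zero, abs_of_nonneg t.coe_nonneg] at h
  linarith [dist_triangle_right (γ.1 t) (γ.1 0) p]

theorem GeodesicRay.le_gromovProduct (γ : GeodesicRay X) (p : X) {s t : ℝ≥0} (h : t ≤ s) :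
    t - dist (γ.1 0) p ≤ gromovProduct p (γ.1 s) (γ.1 t) := by
  have h1 := γ.le_dist_add p s
  have h2 := γ.le_dist_add p t
  have h3 := γ.dist_eq s t
  rw [abs_of_nonneg (sub_nonneg.2 (NNReal.coe_le_coe.2 h))] at h3
  unfold gromovProduct
  linarith

theorem GeodesicRay.eventually_le_gromovProduct_of_endpoint_eq (p : X) {γ σ : GeodesicRay X}
    (h : γ.endpoint = σ.endpoint) (R : ℝ) :
    ∀ᶠ s : ℝ≥0 in atTop, R ≤ gromovProduct p (γ.1 s) (σ.1 s) := by
  obtain ⟨M, hM⟩ : γ.Asymptotic σ := Quotient.exact h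
  filter_upwards [NNReal.tendsto_coe_atTop.2 tendsto_id |>.eventually_ge_atTop
    (R + M + dist (γ.1 0) p)] with s hs
  have h1 := γ.le_gromovProduct p (le_refl s)
  have h2 := gromovProduct_le_add_dist_left p (γ.1 s) (σ.1 s) (γ.1 s)
  rw [gromovProduct_comm p (σ.1 s)] at h2
  have := hM s
  simp only [id] at hs
  linarith

end Rays

/-! ### Neighborhoods of boundary points -/

section Neighborhoods

variable {X : Type*} [MetricSpace X] {δ : ℝ}

theorem of_mem_gromovNhd {p x : X} {η : GromovBoundary X} {R : ℝ} :
    GromovCompactification.of x ∈ gromovNhd p η R ↔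
      ∀ γ : GeodesicRay X, γ.endpoint = η →
        ∀ᶠ t : ℝ≥0 in atTop, R ≤ gromovProduct p x (γ.1 t) := by
  constructor
  · intro h γ hγ
    have := h (fun _ => x) γ.1 rfl ⟨γ, hγ, rfl⟩
    rw [← prod_atTop_atTop_eq] at this
    -- The first path is constant, so any value of its parameter will do.
    exact this.curry.exists.choose_spec
  · rintro h c c' rfl ⟨γ, hγ, rfl⟩
    rw [← prod_atTop_atTop_eq]
    exact (h γ hγ).prod_inr _

theorem FourPointInequality.of_mem_gromovNhd_trans (h4 : FourPointInequality X δ) {p x : X}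
    {η ζ : GromovBoundary X} {R : ℝ}
    (hζ : GromovCompactification.bdry ζ ∈ gromovNhd p η (R + δ))
    (hx : GromovCompactification.of x ∈ gromovNhd p ζ (R + δ)) :
    GromovCompactification.of x ∈ gromovNhd p η R := by
  rw [of_mem_gromovNhd] at hx ⊢
  intro γ hγ
  obtain ⟨σ, hσ⟩ : ∃ σ : GeodesicRay X, σ.endpoint = ζ := Quotient.exists_rep ζ
  have h1 := hζ σ.1 γ.1 ⟨σ, hσ, rfl⟩ ⟨γ, hγ, rfl⟩
  rw [← prod_atTop_atTop_eq] at h1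
  obtain ⟨s, hs, hs'⟩ := (h1.curry.and (hx σ hσ)).exists
  filter_upwards [hs] with t ht
  have := h4 p x (σ.1 s) (γ.1 t)
  have := le_min hs' ht
  linarith

theorem FourPointInequality.of_mem_gromovNhd_of_ray (h4 : FourPointInequality X δ) {p x : X}
    {γ : GeodesicRay X} {R : ℝ}
    (hx : ∀ᶠ t : ℝ≥0 in atTop, R + δ ≤ gromovProduct p x (γ.1 t)) :
    GromovCompactification.of x ∈ gromovNhd p γ.endpoint R := by
  rw [of_mem_gromovNhd]
  intro σ hσ
  filter_upwards [hx, GeodesicRay.eventually_le_gromovProduct_of_endpoint_eq p hσ.symm (R + δ)]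
    with t h1 h2
  have := h4 p x (γ.1 t) (σ.1 t)
  have := le_min h1 h2
  linarith

theorem gromovNhd_add_dist_subset (p q : X) (η : GromovBoundary X) (R : ℝ) :
    gromovNhd q η (R + dist p q) ⊆ gromovNhd p η R := by
  intro ξ hξ c c' hc hc'
  filter_upwards [hξ c c' hc hc'] with st hst
  have := gromovProduct_le_add_dist_base q p (c st.1) (c' st.2)
  rw [dist_comm q p] at this
  linarith

/-- Basic neighborhoods need not be open. The set `U` below plays the role of an interior, and the
four point inequality, through `of_mem_gromovNhd_trans`, shows that it is open. -/
theorem FourPointInequality.gromovNhd_mem_toBoundary (h4 : FourPointInequality X δ) (p : X)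
    (η : GromovBoundary X) (R : ℝ) :
    {x : X | GromovCompactification.of x ∈ gromovNhd p η R} ∈ toBoundary η := by
  set V : Set X := {x : X | GromovCompactification.of x ∈ gromovNhd p η R} with hV
  let U : Set (GromovCompactification X) :=
    {ξ | (∀ x, ξ = .of x → x ∈ interior V) ∧
      ∀ ζ, ξ = .bdry ζ → ∃ S, ∀ x, GromovCompactification.of x ∈ gromovNhd p ζ S → x ∈ V}
  have hU1 : {x : X | GromovCompactification.of x ∈ U} = interior V := by
    ext x
    simp [U]
  have hU : IsOpen U := by
    refine ⟨?_, ?_⟩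
    · rw [hU1]
      exact isOpen_interior
    · intro ζ hζ q
      obtain ⟨S, hS⟩ := hζ.2 ζ rfl
      -- `S + 1` absorbs a move inside a unit ball, `S + δ` one use of the four point inequality,
      -- and `dist p q` the change of base point.
      refine ⟨max (S + 1) (S + δ) + dist p q,
        (gromovNhd_add_dist_subset p q ζ _).trans fun ξ hξ => ⟨?_, ?_⟩⟩
      · rintro x rfl
        refine mem_interior_iff_mem_nhds.2 (mem_of_superset (Metric.ball_mem_nhds x one_pos) ?_)
        intro y hy
        refine hS y (of_mem_gromovNhd.2 fun γ hγ => ?_)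
        filter_upwards [of_mem_gromovNhd.1 hξ γ hγ] with t ht
        have h1 := gromovProduct_le_add_dist_left p x y (γ.1 t)
        have h2 := Metric.mem_ball'.1 hy
        linarith [(le_max_left (S + 1) (S + δ)).trans ht]
      · rintro ζ' rfl
        refine ⟨S + δ, fun x hx => hS x (h4.of_mem_gromovNhd_trans ?_ hx)⟩
        intro c c' hc hc'
        exact (hξ c c' hc hc').mono fun _ h => (le_max_right _ _).trans h
  refine mem_comap.2 ⟨U, hU.mem_nhds ⟨by simp, ?_⟩, ?_⟩
  · rintro ζ hζ
    obtain rfl : η = ζ := by simpa using hζ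
    exact ⟨R, fun x hx => hx⟩
  · exact fun x hx => interior_subset (hx.1 x rfl)

/-- Convergence in `X` to the endpoint of a ray, expressed by Gromov products with that ray. -/
theorem FourPointInequality.tendsto_toBoundary_iff (h4 : FourPointInequality X δ) (p : X)
    (γ : GeodesicRay X) {ι : Type*} {l : Filter ι} {g : ι → X} :
    Tendsto g l (toBoundary γ.endpoint) ↔
      ∀ R : ℝ, ∀ᶠ i in l, ∀ᶠ t : ℝ≥0 in atTop, R ≤ gromovProduct p (g i) (γ.1 t) := by
  constructor
  · intro h R
    filter_upwards [h (h4.gromovNhd_mem_toBoundary p γ.endpoint R)] with i hi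
    exact of_mem_gromovNhd.1 hi γ rfl
  · intro h
    refine tendsto_comap_iff.2 (tendsto_nhds.2 fun U hU hη => ?_)
    obtain ⟨R, hR⟩ := hU.2 _ hη p
    filter_upwards [h (R + δ)] with i hi
    exact hR (h4.of_mem_gromovNhd_of_ray hi)

theorem FourPointInequality.eventually_toBoundary (h4 : FourPointInequality X δ) (p : X)
    (γ : GeodesicRay X) (R : ℝ) :
    ∀ᶠ z in toBoundary γ.endpoint, ∀ᶠ t : ℝ≥0 in atTop, R ≤ gromovProduct p z (γ.1 t) :=
  (h4.tendsto_toBoundary_iff p γ).1 tendsto_id R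

theorem FourPointInequality.tendsto_ray (h4 : FourPointInequality X δ) (γ : GeodesicRay X) :
    Tendsto γ.1 atTop (toBoundary γ.endpoint) := by
  refine (h4.tendsto_toBoundary_iff (γ.1 0) γ).2 fun R => ?_
  filter_upwards [(NNReal.tendsto_coe_atTop.2 tendsto_id).eventually_ge_atTop R] with t ht
  filter_upwards [eventually_ge_atTop t] with s hs
  have h1 := γ.le_gromovProduct (γ.1 0) hs
  rw [gromovProduct_comm, dist_self] at h1
  simp only [id] at ht
  linarith

theorem FourPointInequality.tendsto_toBoundary_of_dist_le (h4 : FourPointInequality X δ)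
    {η : GromovBoundary X} {ι : Type*} {l : Filter ι} {g g' : ι → X} {C : ℝ}
    (hg : Tendsto g l (toBoundary η)) (hC : ∀ i, dist (g i) (g' i) ≤ C) :
    Tendsto g' l (toBoundary η) := by
  obtain ⟨γ, rfl⟩ : ∃ γ : GeodesicRay X, γ.endpoint = η := Quotient.exists_rep η
  rw [h4.tendsto_toBoundary_iff (γ.1 0) γ] at hg ⊢
  intro R
  filter_upwards [hg (R + C)] with i hi
  filter_upwards [hi] with t ht
  have h1 := gromovProduct_le_add_dist_left (γ.1 0) (g i) (g' i) (γ.1 t)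
  linarith [hC i]

end Neighborhoods

/-! ### Non-expanding maps near a boundary point -/

section Nonexpanding

variable {X : Type*} [MetricSpace X] {δ : ℝ}

/-- The amount by which `f` moves `z` towards `p`; its lower limit is the logarithm of the
dilation. -/
def approach (f : X → X) (p z : X) : ℝ :=
  dist z p - dist (f z) p

theorem neg_dist_le_approach {f : X → X} (hf : LipschitzWith 1 f) (p z : X) :
    -dist (f p) p ≤ approach f p z := by
  have h1 := dist_triangle (f z) (f p) p
  have h2 := hf.dist_le_mul z p
  rw [NNReal.coe_one, one_mul] at h2
  unfold approach
  linarith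

theorem approach_le_dist (f : X → X) (p z : X) : approach f p z ≤ dist (f z) z := by
  have := dist_triangle_left z p (f z)
  unfold approach
  linarith

theorem approach_comp (f g : X → X) (p z : X) :
    approach (f ∘ g) p z = approach g p z + approach f p (g z) := by
  simp only [approach, Function.comp_apply]
  ring

theorem approach_le_add_dist_base (f : X → X) (p q z : X) :
    approach f p z ≤ approach f q z + 2 * dist p q := by
  have h1 := dist_triangle_right z p q
  have h2 := dist_triangle (f z) p q
  unfold approach
  linarith

theorem LipschitzWith.dist_iterate_self_le {f : X → X} (hf : LipschitzWith 1 f) {x : X} {K : ℝ}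
    (hK : dist (f x) x ≤ K) (n : ℕ) : dist (f^[n] x) x ≤ n * K := by
  induction n with
  | zero => simp
  | succ n ih =>
    have h1 := hf.dist_le_mul (f^[n] x) x
    rw [NNReal.coe_one, one_mul] at h1
    have h2 := dist_triangle (f (f^[n] x)) (f x) x
    rw [Function.iterate_succ_apply', Nat.cast_succ, add_mul]
    linarith

theorem LipschitzWith.one_iterate {f : X → X} (hf : LipschitzWith 1 f) (n : ℕ) :
    LipschitzWith 1 f^[n] := by
  simpa using hf.iterate n

/-- A Julia type estimate: if `f` does not approach `p` too much along some points tending to the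
endpoint of `γ`, then it goes away from `p` at full speed along `γ`. -/
theorem FourPointInequality.sub_le_dist_of_frequently (h4 : FourPointInequality X δ)
    {f : X → X} (hf : LipschitzWith 1 f) (γ : GeodesicRay X) {p : X} {C : ℝ}
    (hC : ∃ᶠ z in toBoundary γ.endpoint, approach f p z ≤ C) (t : ℝ≥0) :
    t - (3 * dist (γ.1 0) p + 2 * |δ| + C) ≤ dist (f (γ.1 t)) p := by
  -- Seen from `p`, the far point `z` lies beyond `γ t`, so `dist z p - dist z (γ t)` is `t` up to a
  -- constant; applying `f` loses at most `C`.
  obtain ⟨z, hz, hz'⟩ := (hC.and_eventually (h4.eventually_toBoundary p γ t)).exists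
  obtain ⟨s, hs, hst⟩ := (hz'.and (eventually_ge_atTop t)).exists
  have h1 := h4 p z (γ.1 s) (γ.1 t)
  have h2 := γ.le_gromovProduct p hst
  have h3 : t - dist (γ.1 0) p ≤ min (gromovProduct p z (γ.1 s))
      (gromovProduct p (γ.1 s) (γ.1 t)) :=
    le_min (by linarith [dist_nonneg (x := γ.1 0) (y := p)]) h2
  have h5 := γ.le_dist_add p t
  have h6 := γ.dist_le_add p t
  have h7 := hf.dist_le_mul z (γ.1 t)
  rw [NNReal.coe_one, one_mul] at h7
  have h8 := dist_triangle (f z) (f (γ.1 t)) p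
  have h9 := le_abs_self δ
  have h10 : gromovProduct p z (γ.1 t) =
    (dist z p + dist (γ.1 t) p - dist z (γ.1 t)) / 2 := rfl
  unfold approach at hz
  linarith

/-- The Julia estimate at `t` and at a large `n` makes the Gromov product of `f (γ t)` and `f (γ n)`
at least `t` minus a constant. As `f (γ n)` tends to the endpoint, two uses of the four point
inequality replace it by `γ t`. Both points are within `t` plus a constant of `p`, so they are
close. -/
theorem FourPointInequality.exists_dist_ray_le (h4 : FourPointInequality X δ)
    {f : X → X} (hf : LipschitzWith 1 f) (γ : GeodesicRay X) {p : X} {C : ℝ}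
    (hC : ∃ᶠ z in toBoundary γ.endpoint, approach f p z ≤ C)
    (hlim : Tendsto (fun n : ℕ => f (γ.1 n)) atTop (toBoundary γ.endpoint)) :
    ∃ K : ℝ, ∀ t : ℝ≥0, dist (f (γ.1 t)) (γ.1 t) ≤ K := by
  set a := dist (γ.1 0) p with ha
  have ha0 : 0 ≤ a := dist_nonneg
  have hD := h4.sub_le_dist_of_frequently hf γ hC
  rw [← ha] at hD
  set D := 3 * a + 2 * |δ| + C
  refine ⟨dist (f p) p + 4 * a + 2 * |D| + 4 * |δ|, fun t => ?_⟩
  obtain ⟨n, hn, hnt⟩ := (((h4.tendsto_toBoundary_iff p γ).1 hlim t).and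
    (tendsto_natCast_atTop_atTop.eventually_ge_atTop t)).exists
  obtain ⟨s, hs, hst⟩ := (hn.and (eventually_ge_atTop t)).exists
  have hle := abs_of_nonpos (sub_nonpos.2 (NNReal.coe_le_coe.2 hnt))
  have h1 : t - |D| ≤ gromovProduct p (f (γ.1 t)) (f (γ.1 n)) := by
    have e1 := hD t
    have e2 := hD n
    have e3 := hf.dist_le_mul (γ.1 t) (γ.1 n)
    rw [NNReal.coe_one, one_mul, γ.dist_eq, hle] at e3
    have := le_abs_self D
    unfold gromovProduct
    linarith
  have hD0 := abs_nonneg D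
  have hδ0 := abs_nonneg δ
  have hδ1 := le_abs_self δ
  have h2 := h4 p (f (γ.1 t)) (f (γ.1 n)) (γ.1 s)
  have h3 := le_min h1 (le_trans (by linarith) hs)
  have h5 := γ.le_gromovProduct p hst
  have h6 := h4 p (f (γ.1 t)) (γ.1 s) (γ.1 t)
  have h7 : t - |D| - a - |δ| ≤
      min (gromovProduct p (f (γ.1 t)) (γ.1 s)) (gromovProduct p (γ.1 s) (γ.1 t)) :=
    le_min (by linarith) (by linarith)
  have h8 : gromovProduct p (f (γ.1 t)) (γ.1 t) =
    (dist (f (γ.1 t)) p + dist (γ.1 t) p - dist (f (γ.1 t)) (γ.1 t)) / 2 := rfl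
  have h9 := neg_dist_le_approach hf p (γ.1 t)
  have h10 := γ.dist_le_add p t
  unfold approach at h9
  linarith

/-- A non-expanding map which moves the points of a ray by a bounded amount fixes the endpoint of
the ray, as long as points are not moved too much towards `p`. -/
theorem FourPointInequality.tendsto_of_approach_le (h4 : FourPointInequality X δ)
    {f : X → X} (hf : LipschitzWith 1 f) (γ : GeodesicRay X) {K : ℝ}
    (hK : ∀ t : ℝ≥0, dist (f (γ.1 t)) (γ.1 t) ≤ K) (p : X) (C : ℝ) :
    Tendsto f (toBoundary γ.endpoint ⊓ 𝓟 {z | approach f p z ≤ C})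
      (toBoundary γ.endpoint) := by
  refine (h4.tendsto_toBoundary_iff p γ).2 fun R => ?_
  rw [eventually_inf_principal]
  -- Applying `f` lowers the distance to `p` by at most `C` and raises that to `γ t` by at most `K`;
  -- the product loses half the sum.
  filter_upwards [h4.eventually_toBoundary p γ (R + (C + K) / 2)] with z hz hzC
  filter_upwards [hz] with t ht
  have h1 := dist_triangle (f z) (f (γ.1 t)) (γ.1 t)
  have h2 := hf.dist_le_mul z (γ.1 t)
  rw [NNReal.coe_one, one_mul] at h2
  have h3 := hK t
  change dist z p - dist (f z) p ≤ C at hzC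
  unfold gromovProduct at ht ⊢
  linarith

end Nonexpanding

/-! ### The dilation -/

section Dilation

variable {X : Type*} [MetricSpace X] {δ : ℝ}

theorem dilation_eq_exp_liminf (f : X → X) (η : GromovBoundary X) (p : X) :
    dilation f η p =
      EReal.exp (liminf (fun z => (approach f p z : EReal)) (toBoundary η)) :=
  rfl

theorem dilation_pos {f : X → X} (hf : LipschitzWith 1 f) (η : GromovBoundary X) (p : X) :
    0 < dilation f η p := by
  rw [dilation_eq_exp_liminf, EReal.zero_lt_exp_iff]
  refine (EReal.bot_lt_coe (-dist (f p) p)).trans_le (le_liminf_of_le (by isBoundedDefault) ?_)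
  exact Eventually.of_forall fun z => EReal.coe_le_coe_iff.2 (neg_dist_le_approach hf p z)

theorem dilation_lt_top {f : X → X} {η : GromovBoundary X} {p : X} {C : ℝ}
    (hC : ∃ᶠ z in toBoundary η, approach f p z ≤ C) : dilation f η p < ⊤ := by
  rw [dilation_eq_exp_liminf, EReal.exp_lt_top_iff]
  refine lt_of_le_of_lt (liminf_le_of_frequently_le' (hC.mono fun z hz => ?_))
    (EReal.coe_lt_top C)
  exact EReal.coe_le_coe_iff.2 hz

theorem exists_frequently_approach_le {f : X → X} {η : GromovBoundary X} {p : X}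
    (h : dilation f η p < ⊤) : ∃ C : ℝ, ∃ᶠ z in toBoundary η, approach f p z ≤ C := by
  rw [dilation_eq_exp_liminf, EReal.exp_lt_top_iff] at h
  obtain ⟨C, hC, -⟩ := EReal.lt_iff_exists_real_btwn.1 h
  refine ⟨C, (frequently_lt_of_liminf_lt (by isBoundedDefault) hC).mono fun z hz => ?_⟩
  exact (EReal.coe_lt_coe_iff.1 hz).le

/-- The real logarithm of the dilation. -/
noncomputable def logDilation (f : X → X) (η : GromovBoundary X) (p : X) : ℝ :=
  Real.log (dilation f η p).toReal

theorem coe_logDilation {f : X → X} {η : GromovBoundary X} {p : X}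
    (h0 : 0 < dilation f η p) (h1 : dilation f η p < ⊤) :
    (logDilation f η p : EReal) =
      liminf (fun z => (approach f p z : EReal)) (toBoundary η) := by
  rw [dilation_eq_exp_liminf] at h0 h1
  rw [logDilation, dilation_eq_exp_liminf]
  rw [EReal.zero_lt_exp_iff] at h0
  rw [EReal.exp_lt_top_iff] at h1
  lift liminf (fun z => (approach f p z : EReal)) (toBoundary η) to ℝ
    using ⟨h1.ne, h0.ne'⟩ with r
  rw [EReal.exp_coe, ENNReal.toReal_ofReal (Real.exp_pos r).le, Real.log_exp]

theorem logDilation_le {f : X → X} {η : GromovBoundary X} {p : X}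
    (h0 : 0 < dilation f η p) {C : ℝ} (hC : ∃ᶠ z in toBoundary η, approach f p z ≤ C) :
    logDilation f η p ≤ C := by
  rw [← EReal.coe_le_coe_iff, coe_logDilation h0 (dilation_lt_top hC)]
  exact liminf_le_of_frequently_le' (hC.mono fun z hz => EReal.coe_le_coe_iff.2 hz)

theorem le_logDilation {f : X → X} {η : GromovBoundary X} {p : X}
    (h0 : 0 < dilation f η p) (h1 : dilation f η p < ⊤) {c : ℝ}
    (hc : ∀ᶠ z in toBoundary η, c ≤ approach f p z) : c ≤ logDilation f η p := by
  rw [← EReal.coe_le_coe_iff, coe_logDilation h0 h1]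
  exact le_liminf_of_le (by isBoundedDefault) (hc.mono fun z hz => EReal.coe_le_coe_iff.2 hz)

theorem eventually_lt_approach {f : X → X} {η : GromovBoundary X} {p : X}
    (h0 : 0 < dilation f η p) (h1 : dilation f η p < ⊤) {c : ℝ} (hc : c < logDilation f η p) :
    ∀ᶠ z in toBoundary η, c < approach f p z := by
  rw [← EReal.coe_lt_coe_iff, coe_logDilation h0 h1] at hc
  exact (eventually_lt_of_lt_liminf hc).mono fun z hz => EReal.coe_lt_coe_iff.1 hz

theorem logDilation_le_add_dist_base {f : X → X} {η : GromovBoundary X} {p q : X}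
    (hp : 0 < dilation f η p) (hp' : dilation f η p < ⊤)
    (hq : 0 < dilation f η q) (hq' : dilation f η q < ⊤) :
    logDilation f η p ≤ logDilation f η q + 2 * dist p q := by
  refine le_of_forall_pos_sub_le fun ε hε => ?_
  rw [sub_le_iff_le_add, add_right_comm, ← sub_le_iff_le_add, ← sub_le_iff_le_add]
  refine le_logDilation hq hq' ?_
  filter_upwards [eventually_lt_approach hp hp' (sub_lt_self _ hε)] with z hz
  linarith [approach_le_add_dist_base f p q z]

theorem FourPointInequality.frequently_approach_le (h4 : FourPointInequality X δ)
    {f : X → X} (γ : GeodesicRay X) {K : ℝ} (hK : ∀ t : ℝ≥0, dist (f (γ.1 t)) (γ.1 t) ≤ K)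
    (p : X) : ∃ᶠ z in toBoundary γ.endpoint, approach f p z ≤ K :=
  (h4.tendsto_ray γ).frequently
    (Frequently.of_forall fun t => (approach_le_dist f p (γ.1 t)).trans (hK t))

theorem FourPointInequality.logDilation_add_le (h4 : FourPointInequality X δ)
    {f g : X → X} (hf : LipschitzWith 1 f) (hg : LipschitzWith 1 g) (γ : GeodesicRay X)
    {K : ℝ} (hK : ∀ t : ℝ≥0, dist (g (γ.1 t)) (γ.1 t) ≤ K) {p : X}
    (hf' : dilation f γ.endpoint p < ⊤) (hfg' : dilation (f ∘ g) γ.endpoint p < ⊤) :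
    logDilation f γ.endpoint p + logDilation g γ.endpoint p ≤
      logDilation (f ∘ g) γ.endpoint p := by
  set a := logDilation f γ.endpoint p
  set b := logDilation g γ.endpoint p
  have hf0 := dilation_pos hf γ.endpoint p
  have hg0 := dilation_pos hg γ.endpoint p
  have hg' := dilation_lt_top (h4.frequently_approach_le γ hK p)
  refine le_of_forall_pos_sub_le fun ε hε => ?_
  refine le_logDilation (dilation_pos (by simpa using hf.comp hg) _ _) hfg' ?_
  -- Above this threshold, `approach f p (g z) ≥ -dist (f p) p` already gives a sum exceeding `a +
  -- b`.
  have hlim := h4.tendsto_of_approach_le hg γ hK p (a + b + dist (f p) p)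
  have h1 := hlim.eventually (eventually_lt_approach hf0 hf'
    (sub_lt_self a (half_pos hε)))
  rw [eventually_inf_principal] at h1
  filter_upwards [h1, eventually_lt_approach hg0 hg' (sub_lt_self b (half_pos hε))] with z hz hz'
  rw [approach_comp]
  by_cases hzC : approach g p z ≤ a + b + dist (f p) p
  · linarith [hz hzC]
  · linarith [neg_dist_le_approach hf p (g z)]

end Dilation

/-! ### Boundary regular fixed points -/

section BRFP

variable {X : Type*} [MetricSpace X] {δ : ℝ}

theorem FourPointInequality.exists_dist_ray_le_of_isBRFP (h4 : FourPointInequality X δ)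
    {f : X → X} (hf : LipschitzWith 1 f) (γ : GeodesicRay X) (hη : IsBRFP f γ.endpoint) :
    ∃ K : ℝ, ∀ t : ℝ≥0, dist (f (γ.1 t)) (γ.1 t) ≤ K := by
  obtain ⟨⟨p, hp⟩, hlim⟩ := hη
  obtain ⟨C, hC⟩ := exists_frequently_approach_le hp
  refine h4.exists_dist_ray_le hf γ hC (tendsto_comap_iff.2 ?_)
  refine hlim γ 1 (fun n => γ.1 n) rfl one_pos (fun n => ?_)
    ((h4.tendsto_ray γ).comp tendsto_natCast_atTop_atTop)
  exact Metric.self_subset_thickening one_pos _ ⟨_, rfl⟩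

/-- Points within `R` of the ray are moved by at most `R + R + K`, and a bounded perturbation does
not affect convergence to `η`. -/
theorem FourPointInequality.hasGeodesicLimit (h4 : FourPointInequality X δ)
    {f : X → X} (hf : LipschitzWith 1 f) {η : GromovBoundary X}
    (hK : ∀ γ : GeodesicRay X, γ.endpoint = η →
      ∃ K : ℝ, ∀ t : ℝ≥0, dist (f (γ.1 t)) (γ.1 t) ≤ K) :
    HasGeodesicLimit (fun z => GromovCompactification.of (f z)) η
      (GromovCompactification.bdry η) := by
  intro γ R x hγ hR hx hlim
  obtain ⟨K, hK⟩ := hK γ hγ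
  refine tendsto_comap_iff.1 (h4.tendsto_toBoundary_of_dist_le (C := R + R + K) hlim fun n => ?_)
  obtain ⟨_, ⟨t, rfl⟩, ht⟩ := Metric.mem_thickening_iff.1 (hx n)
  have h1 := hf.dist_le_mul (x n) (γ.1 t)
  rw [NNReal.coe_one, one_mul] at h1
  have h2 := dist_triangle4 (x n) (γ.1 t) (f (γ.1 t)) (f (x n))
  have h3 := hK t
  rw [dist_comm (γ.1 t), dist_comm (f (γ.1 t)) (f (x n))] at h2
  linarith

end BRFP

theorem theorem3p3 {X : Type*} [MetricSpace X] [ProperSpace X]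
    (hgeo : IsGeodesicSpace X) (hhyp : IsGromovHyperbolic X)
    (f : X → X) (hf : LipschitzWith 1 f) (η : GromovBoundary X) (hη : IsBRFP f η) :
    (∀ n : ℕ, 1 ≤ n → IsBRFP f^[n] η) ∧
    (∀ (p : X) (n : ℕ), 1 ≤ n → 0 < dilation f^[n] η p ∧ dilation f^[n] η p < ⊤) ∧
    (∀ (p : X) (n m : ℕ), 1 ≤ n → 1 ≤ m →
      Real.log (dilation f^[n] η p).toReal + Real.log (dilation f^[m] η p).toReal ≤
        Real.log (dilation f^[n + m] η p).toReal) ∧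
    (∃ Λ : ℝ, 0 < Λ ∧ ∀ p : X,
      Tendsto (fun n : ℕ => Real.log (dilation f^[n] η p).toReal / (n : ℝ)) atTop
        (𝓝 (Real.log Λ))) := by
  obtain ⟨δ, hδ, hX⟩ := hhyp
  have h4 := hX.fourPointInequality hδ hgeo
  have hdisp : ∀ γ : GeodesicRay X, γ.endpoint = η →
      ∃ K : ℝ, ∀ (n : ℕ) (t : ℝ≥0), dist (f^[n] (γ.1 t)) (γ.1 t) ≤ n * K := by
    rintro γ rfl
    obtain ⟨K, hK⟩ := h4.exists_dist_ray_le_of_isBRFP hf γ hη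
    exact ⟨K, fun n t => hf.dist_iterate_self_le (hK t) n⟩
  have hgl (n : ℕ) := h4.hasGeodesicLimit (hf.one_iterate n)
    fun γ hγ => (hdisp γ hγ).imp' (fun K => n * K) fun K hK => hK n
  obtain ⟨γ, rfl⟩ : ∃ γ : GeodesicRay X, γ.endpoint = η := Quotient.exists_rep η
  obtain ⟨K, hK⟩ := hdisp γ rfl
  have hpos (n : ℕ) (p : X) := dilation_pos (hf.one_iterate n) γ.endpoint p
  have hfreq (n : ℕ) (p : X) := h4.frequently_approach_le γ (hK n) p
  have hfin (n : ℕ) (p : X) := dilation_lt_top (hfreq n p)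
  have hadd (p : X) (n m : ℕ) : logDilation f^[n] γ.endpoint p + logDilation f^[m] γ.endpoint p ≤
      logDilation f^[n + m] γ.endpoint p := by
    have h := hfin (n + m) p
    rw [Function.iterate_add] at h ⊢
    exact h4.logDilation_add_le (hf.one_iterate n) (hf.one_iterate m) γ (hK m) (hfin n p) h
  refine ⟨fun n _ => ⟨⟨γ.1 0, hfin n _⟩, hgl n⟩, fun p n _ => ⟨hpos n p, hfin n p⟩,
    fun p n m _ _ => hadd p n m, ?_⟩
  set q := γ.1 0
  have hsub : Subadditive fun n => -logDilation f^[n] γ.endpoint q := fun n m => by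
    linarith [hadd q n m]
  have hbdd : BddBelow (Set.range fun n : ℕ => -logDilation f^[n] γ.endpoint q / n) := by
    -- The `0` handles the term `n = 0`, where division by zero gives `0`.
    refine ⟨min 0 (-K), ?_⟩
    rintro _ ⟨n, rfl⟩
    rcases n.eq_zero_or_pos with rfl | hn
    · simp
    · refine (min_le_right _ _).trans ((le_div_iff₀ (Nat.cast_pos.2 hn)).2 ?_)
      linarith [logDilation_le (hpos n q) (hfreq n q)]
  have hlim : Tendsto (fun n : ℕ => logDilation f^[n] γ.endpoint q / n) atTop
      (𝓝 (-hsub.lim)) := by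
    refine (hsub.tendsto_lim hbdd).neg.congr fun n => ?_
    rw [neg_div, neg_neg]
  refine ⟨Real.exp (-hsub.lim), Real.exp_pos _, fun p => ?_⟩
  rw [Real.log_exp]
  refine hlim.congr_dist (squeeze_zero (fun _ => dist_nonneg) (fun n => ?_)
    (tendsto_const_div_atTop_nhds_zero_nat (2 * dist q p)))
  have h1 := logDilation_le_add_dist_base (hpos n q) (hfin n q) (hpos n p) (hfin n p)
  have h2 := logDilation_le_add_dist_base (hpos n p) (hfin n p) (hpos n q) (hfin n q)
  rw [dist_comm p q] at h2
  rw [Real.dist_eq, ← sub_div, abs_div, Nat.abs_cast]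
  refine div_le_div_of_nonneg_right (abs_sub_le_iff.2 ⟨?_, ?_⟩) n.cast_nonneg
  · exact sub_le_iff_le_add'.2 h1
  · exact sub_le_iff_le_add'.2 h2
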